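/- **Proposition (answer to Sodin's question).** There is an absolute constant $C$ with the following property. Let $N \ge 0$ be an integer and let $\mu$ be a (positive) Borel measure on $\mathbb{C}$ supported by the square $\mathcal{Q}=\{x+iy : |x|\le \tfrac12,\ |y|\le\tfrac12\}$ with $\mu(\mathcal{Q})=N$. Then there is a polynomial $P_N$ with complex coefficients, of degree exactly $N$, such that $$\iint_{\Xi} \bigl|\mathcal{U}_\mu(z)-\log|P_N(z)|\bigr|\,dx\,dy < C, \qquad \Xi=\{z=x+iy : |x|\le 1,\ |y|\le 1\},$$ where $\mathcal{U}_\mu(z)=\int \log|z-\zeta|\,d\mu(\zeta)$ is the logarithmic potential of $\mu$. -/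

import Mathlib

open MeasureTheory

/-- The closed square `{x + iy : |x| ≤ a, |y| ≤ a}` in the complex plane. -/
def closedSquare (a : ℝ) : Set ℂ := {z : ℂ | |z.re| ≤ a ∧ |z.im| ≤ a}

/-- `log |w|` with values in `[-∞, ∞]`, so that `log |0| = -∞`. -/
noncomputable def logAbs (w : ℂ) : EReal := ENNReal.log ‖w‖ₑ

/-- The logarithmic potential `U_μ(z) = ∫ log |z - ζ| dμ(ζ)` of a Borel measure `μ` on the plane,
with values in `[-∞, ∞]`: the integral of the positive part of the kernel minus the integral of
its negative part. For a finite measure with compact support the first integral is finite. -/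
noncomputable def logPotential (μ : Measure ℂ) (z : ℂ) : EReal :=
  ((∫⁻ ζ, (logAbs (z - ζ)).toENNReal ∂μ : ENNReal) : EReal) -
    ((∫⁻ ζ, (-logAbs (z - ζ)).toENNReal ∂μ : ENNReal) : EReal)

/-! Replace a piece of mass two in a disc of radius `d` by two point masses with the same first two
moments. The Taylor terms of `log |z - ζ|` up to order two then cancel, and the difference of the
potentials decays like `(d / |z|) ^ 3`. This is integrable at infinity in the plane, so by scaling
the `L¹` error is `O(d ^ 2)` (`exists_two_points_lintegral_le`). One point per unit mass would match
only the first moment, and decay of order two is not integrable.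

It remains to cut `μ` into pieces of mass two whose squared radii have a bounded sum. A curve of
Hölder exponent `1/2` fills the square (`exists_holder_curve_covering_square`), and `μ` is the image
of Lebesgue measure on `(0, N]` under `γ ∘ q` with `q` monotone into `[0, 1]`
(`exists_monotone_map_comp_eq`). The interval from `2k` to `2k + 2` gives a piece of squared radius
`O(q (2k + 2) - q (2k))`, and these increments telescope to at most `1`. If `N` is odd, the last
unit of mass is replaced by a zero at the origin, at bounded cost. -/

/-! ### A space-filling curve that is Hölder continuous of exponent `1/2` -/

/-- The apex of the right isosceles triangle with hypotenuse `[0, 1]`. -/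
noncomputable def triangleApex : ℂ := ⟨1 / 2, 1 / 2⟩

/-- Iterates converging to the Sierpiński curve, which fills the triangle `0, 1, triangleApex`. -/
noncomputable def sierpinskiIter : ℕ → ℝ → ℂ
  | 0, t => t
  | n + 1, t =>
    if t ≤ 1 / 2 then triangleApex * star (sierpinskiIter n (2 * t))
    else triangleApex + (1 - triangleApex) * star (sierpinskiIter n (2 * t - 1))

/-- Halving the time interval halves squared distances; this is the source of the Hölder exponent
`1/2`. -/
lemma sq_norm_triangleApex : ‖triangleApex‖ ^ 2 = 1 / 2 := by
  rw [Complex.sq_norm, Complex.normSq_apply]; norm_num [triangleApex]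

lemma sq_norm_one_sub_triangleApex : ‖1 - triangleApex‖ ^ 2 = 1 / 2 := by
  rw [Complex.sq_norm, Complex.normSq_apply]; norm_num [triangleApex]

lemma norm_triangleApex_le : ‖triangleApex‖ ≤ 3 / 4 :=
  abs_le_of_sq_le_sq' (by rw [sq_norm_triangleApex]; norm_num) (by norm_num) |>.2

lemma norm_one_sub_triangleApex_le : ‖1 - triangleApex‖ ≤ 3 / 4 :=
  abs_le_of_sq_le_sq' (by rw [sq_norm_one_sub_triangleApex]; norm_num) (by norm_num) |>.2

lemma sierpinskiIter_at_zero (n : ℕ) : sierpinskiIter n 0 = 0 := by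
  induction n with
  | zero => simp [sierpinskiIter]
  | succ n ih => simp [sierpinskiIter, ih]

lemma sierpinskiIter_at_one (n : ℕ) : sierpinskiIter n 1 = 1 := by
  induction n with
  | zero => simp [sierpinskiIter]
  | succ n ih =>
    have h : (2 * 1 - 1 : ℝ) = 1 := by norm_num
    simp only [sierpinskiIter, h, ih]
    norm_num

lemma norm_sierpinskiIter_le (n : ℕ) : ∀ t ∈ Set.Icc (0 : ℝ) 1, ‖sierpinskiIter n t‖ ≤ 4 := by
  induction n with
  | zero =>
    rintro t ⟨h0, h1⟩
    simp only [sierpinskiIter, Complex.norm_real, Real.norm_eq_abs, abs_of_nonneg h0]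
    linarith
  | succ n ih =>
    rintro t ⟨h0, h1⟩
    have hb := norm_triangleApex_le
    have hb' := norm_one_sub_triangleApex_le
    simp only [sierpinskiIter]
    split_ifs with h
    · have := ih (2 * t) ⟨by linarith, by linarith⟩
      rw [norm_mul, norm_star]
      nlinarith [norm_nonneg triangleApex, norm_nonneg (sierpinskiIter n (2 * t))]
    · have := ih (2 * t - 1) ⟨by linarith, by linarith⟩
      refine (norm_add_le _ _).trans ?_
      rw [norm_mul, norm_star]
      nlinarith [norm_nonneg (1 - triangleApex), norm_nonneg (sierpinskiIter n (2 * t - 1))]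

lemma dist_sierpinskiIter_succ_le (n : ℕ) : ∀ t ∈ Set.Icc (0 : ℝ) 1,
    dist (sierpinskiIter n t) (sierpinskiIter (n + 1) t) ≤ 8 * (3 / 4) ^ n := by
  induction n with
  | zero =>
    intro t ht
    rw [dist_eq_norm]
    refine (norm_sub_le _ _).trans ?_
    linarith [norm_sierpinskiIter_le 0 t ht, norm_sierpinskiIter_le 1 t ht]
  | succ n ih =>
    rintro t ⟨h0, h1⟩
    have hb := norm_triangleApex_le
    have hb' := norm_one_sub_triangleApex_le
    rw [sierpinskiIter, sierpinskiIter, dist_eq_norm]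
    split_ifs with h
    · have := ih (2 * t) ⟨by linarith, by linarith⟩
      rw [dist_eq_norm] at this
      rw [← mul_sub, ← star_sub, norm_mul, norm_star]
      refine (mul_le_mul hb this (norm_nonneg _) (by norm_num)).trans_eq ?_
      ring
    · have := ih (2 * t - 1) ⟨by linarith, by linarith⟩
      rw [dist_eq_norm] at this
      rw [add_sub_add_left_eq_sub, ← mul_sub, ← star_sub, norm_mul, norm_star]
      refine (mul_le_mul hb' this (norm_nonneg _) (by norm_num)).trans_eq ?_
      ring

/-- A curve with the self-similarity of the Sierpiński curve. -/
structure IsSierpinskiCurve (γ : ℝ → ℂ) : Prop where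
  zero : γ 0 = 0
  one : γ 1 = 1
  norm_le : ∀ t ∈ Set.Icc (0 : ℝ) 1, ‖γ t‖ ≤ 4
  left : ∀ t, 0 ≤ t → t ≤ 1 / 2 → γ t = triangleApex * star (γ (2 * t))
  right : ∀ t, 1 / 2 ≤ t → t ≤ 1 →
    γ t = triangleApex + (1 - triangleApex) * star (γ (2 * t - 1))

lemma exists_isSierpinskiCurve : ∃ γ : ℝ → ℂ, IsSierpinskiCurve γ := by
  have hlim : ∀ t : ℝ, ∃ z : ℂ, t ∈ Set.Icc (0 : ℝ) 1 →
      Filter.Tendsto (fun n => sierpinskiIter n t) Filter.atTop (nhds z) := by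
    intro t
    by_cases ht : t ∈ Set.Icc (0 : ℝ) 1
    · obtain ⟨z, hz⟩ := cauchySeq_tendsto_of_complete
        (cauchySeq_of_le_geometric (3 / 4) 8 (f := fun n => sierpinskiIter n t) (by norm_num)
          fun n => dist_sierpinskiIter_succ_le n t ht)
      exact ⟨z, fun _ => hz⟩
    · exact ⟨0, fun h => absurd h ht⟩
  choose γ hγ using hlim
  have h0 : γ 0 = 0 := tendsto_nhds_unique (hγ 0 (by simp))
    (by simp only [sierpinskiIter_at_zero]; exact tendsto_const_nhds)
  have h1 : γ 1 = 1 := tendsto_nhds_unique (hγ 1 (by simp))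
    (by simp only [sierpinskiIter_at_one]; exact tendsto_const_nhds)
  have hl : ∀ t, 0 ≤ t → t ≤ 1 / 2 → γ t = triangleApex * star (γ (2 * t)) := by
    intro t ht ht'
    refine tendsto_nhds_unique
      ((hγ t ⟨by linarith, by linarith⟩).comp (Filter.tendsto_add_atTop_nat 1)) ?_
    have := ((hγ (2 * t) ⟨by linarith, by linarith⟩).star).const_mul triangleApex
    refine this.congr fun n => ?_
    simp only [Function.comp, sierpinskiIter, if_pos ht']
  refine ⟨γ, h0, h1, fun t ht => ?_, hl, fun t ht ht' => ?_⟩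
  · exact le_of_tendsto' (hγ t ht).norm fun n => norm_sierpinskiIter_le n t ht
  -- The iterates take the left branch at `1 / 2`. The right formula also holds there because both
  -- branches give the apex, by `γ 1 = 1` and `γ 0 = 0`.
  · rcases ht.eq_or_lt with rfl | ht
    · rw [hl (1 / 2) (by norm_num) le_rfl]
      norm_num [h0, h1]
    · refine tendsto_nhds_unique
        ((hγ t ⟨by linarith, by linarith⟩).comp (Filter.tendsto_add_atTop_nat 1)) ?_
      have := (((hγ (2 * t - 1) ⟨by linarith, by linarith⟩).star).const_mul
        (1 - triangleApex)).const_add triangleApex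
      refine this.congr fun n => ?_
      simp only [Function.comp, sierpinskiIter, if_neg ht.not_ge]

/-- Serves the metric estimates below: both sides of each estimate scale by `1 / 2` under
subdivision, so an induction carries a crude bound down to a geometrically small error. -/
lemma le_of_forall_le_add_geometric {a b c : ℝ} (h : ∀ n : ℕ, a ≤ b + c * (1 / 2) ^ n) : a ≤ b := by
  have : Filter.Tendsto (fun n : ℕ => b + c * (1 / 2 : ℝ) ^ n) Filter.atTop (nhds (b + c * 0)) :=
    ((tendsto_pow_atTop_nhds_zero_of_lt_one (by norm_num) (by norm_num)).const_mul c).const_add b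
  simpa using ge_of_tendsto' this h

namespace IsSierpinskiCurve

/-- The left half reproduces the estimate by self-similarity; on the right half the crude bound `4 ^
2 ≤ 32 * t` suffices. -/
lemma sq_norm_le {γ : ℝ → ℂ} (h : IsSierpinskiCurve γ) {t : ℝ}
    (ht : t ∈ Set.Icc (0 : ℝ) 1) : ‖γ t‖ ^ 2 ≤ 32 * t := by
  suffices H : ∀ n : ℕ, ∀ t ∈ Set.Icc (0 : ℝ) 1, ‖γ t‖ ^ 2 ≤ 32 * t + 16 * (1 / 2) ^ n from
    le_of_forall_le_add_geometric fun n => H n t ht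
  intro n
  induction n with
  | zero =>
    intro t ht
    nlinarith [h.norm_le t ht, norm_nonneg (γ t), ht.1]
  | succ n ih =>
    intro t ht
    rcases le_total t (1 / 2) with h2 | h2
    · have := ih (2 * t) ⟨by linarith [ht.1], by linarith⟩
      rw [h.left t ht.1 h2, norm_mul, norm_star, mul_pow, sq_norm_triangleApex,
        pow_succ (1 / 2 : ℝ)]
      linarith
    · have : (0 : ℝ) < (1 / 2) ^ (n + 1) := by positivity
      nlinarith [h.norm_le t ht, norm_nonneg (γ t), ht.1]

lemma sq_norm_sub_one_le {γ : ℝ → ℂ} (h : IsSierpinskiCurve γ) {t : ℝ}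
    (ht : t ∈ Set.Icc (0 : ℝ) 1) : ‖γ t - 1‖ ^ 2 ≤ 50 * (1 - t) := by
  suffices H : ∀ n : ℕ, ∀ t ∈ Set.Icc (0 : ℝ) 1,
      ‖γ t - 1‖ ^ 2 ≤ 50 * (1 - t) + 25 * (1 / 2) ^ n from
    le_of_forall_le_add_geometric fun n => H n t ht
  have hb : ∀ t ∈ Set.Icc (0 : ℝ) 1, ‖γ t - 1‖ ^ 2 ≤ 25 := fun t ht => by
    have h1 : ‖γ t - 1‖ ≤ 5 := by
      refine (norm_sub_le _ _).trans ?_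
      rw [norm_one]; linarith [h.norm_le t ht]
    nlinarith [norm_nonneg (γ t - 1)]
  intro n
  induction n with
  | zero =>
    intro t ht
    linarith [hb t ht, ht.2, pow_zero (1 / 2 : ℝ)]
  | succ n ih =>
    intro t ht
    rcases le_total (1 / 2) t with h2 | h2
    · have := ih (2 * t - 1) ⟨by linarith, by linarith [ht.2]⟩
      have e : triangleApex + (1 - triangleApex) * star (γ (2 * t - 1)) - 1
          = (1 - triangleApex) * star (γ (2 * t - 1) - 1) := by
        rw [star_sub, star_one]; ring
      rw [h.right t h2 ht.2, e, norm_mul, norm_star, mul_pow, sq_norm_one_sub_triangleApex,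
        pow_succ (1 / 2 : ℝ)]
      linarith
    · have : (0 : ℝ) < (1 / 2) ^ (n + 1) := by positivity
      linarith [hb t ht]

lemma sq_norm_sub_le_of_le {γ : ℝ → ℂ} (h : IsSierpinskiCurve γ) {s t : ℝ} (hs : 0 ≤ s)
    (hst : s ≤ t) (ht : t ≤ 1) :
    ‖γ t - γ s‖ ^ 2 ≤ 100 * (t - s) := by
  suffices H : ∀ n : ℕ, ∀ s t : ℝ, 0 ≤ s → s ≤ t → t ≤ 1 →
      ‖γ t - γ s‖ ^ 2 ≤ 100 * (t - s) + 64 * (1 / 2) ^ n from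
    le_of_forall_le_add_geometric fun n => H n s t hs hst ht
  intro n
  induction n with
  | zero =>
    intro s t hs hst ht
    have h1 : ‖γ t - γ s‖ ≤ 8 := by
      refine (norm_sub_le _ _).trans ?_
      linarith [h.norm_le t ⟨by linarith, ht⟩, h.norm_le s ⟨hs, by linarith⟩]
    nlinarith [norm_nonneg (γ t - γ s)]
  | succ n ih =>
    intro s t hs hst ht
    rcases le_total t (1 / 2) with h2 | h2
    · have := ih (2 * s) (2 * t) (by linarith) (by linarith) (by linarith)
      rw [h.left t (by linarith) h2, h.left s hs (by linarith), ← mul_sub, ← star_sub, norm_mul,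
        norm_star, mul_pow, sq_norm_triangleApex,
        pow_succ (1 / 2 : ℝ)]
      linarith
    rcases le_total (1 / 2) s with h3 | h3
    · have := ih (2 * s - 1) (2 * t - 1) (by linarith) (by linarith) (by linarith)
      rw [h.right t h2 ht, h.right s h3 (by linarith), add_sub_add_left_eq_sub, ← mul_sub,
        ← star_sub, norm_mul, norm_star, mul_pow, sq_norm_one_sub_triangleApex,
        pow_succ (1 / 2 : ℝ)]
      linarith
    -- When `s ≤ 1 / 2 ≤ t`, pass through the apex `γ (1 / 2)` and use the endpoint estimates on
    -- each half. The constant is `100 = 2 * 50`, from `(a + b) ^ 2 ≤ 2 * (a ^ 2 + b ^ 2)`.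
    · have e : γ t - γ s = (1 - triangleApex) * star (γ (2 * t - 1))
          - triangleApex * star (γ (2 * s) - 1) := by
        rw [h.right t h2 ht, h.left s hs h3, star_sub, star_one]; ring
      have h4 := h.sq_norm_le (t := 2 * t - 1) ⟨by linarith, by linarith⟩
      have h5 := h.sq_norm_sub_one_le (t := 2 * s) ⟨by linarith, by linarith⟩
      have h6 := norm_sub_le ((1 - triangleApex) * star (γ (2 * t - 1)))
        (triangleApex * star (γ (2 * s) - 1))
      have h7 : ‖(1 - triangleApex) * star (γ (2 * t - 1))‖ ^ 2 ≤ 32 * (t - 1 / 2) := by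
        rw [norm_mul, norm_star, mul_pow, sq_norm_one_sub_triangleApex]; linarith
      have h8 : ‖triangleApex * star (γ (2 * s) - 1)‖ ^ 2 ≤ 50 * (1 / 2 - s) := by
        rw [norm_mul, norm_star, mul_pow, sq_norm_triangleApex]; linarith
      rw [← e] at h6
      have h9 : (0 : ℝ) < (1 / 2) ^ (n + 1) := by positivity
      have h10 := pow_le_pow_left₀ (norm_nonneg _) h6 2
      nlinarith [add_sq_le (a := ‖(1 - triangleApex) * star (γ (2 * t - 1))‖)
        (b := ‖triangleApex * star (γ (2 * s) - 1)‖)]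

/-- The altitude cuts the triangle into two similar copies. Pulling `z` back through the similarity
of the copy containing it gains a factor `1 / 2` at each step. -/
lemma exists_sq_norm_sub_le {γ : ℝ → ℂ} (h : IsSierpinskiCurve γ) (n : ℕ) :
    ∀ z : ℂ, 0 ≤ z.im → z.im ≤ z.re → z.im ≤ 1 - z.re →
    ∃ t ∈ Set.Icc (0 : ℝ) 1, ‖γ t - z‖ ^ 2 ≤ 2 * (1 / 2) ^ n := by
  induction n with
  | zero =>
    intro z h1 h2 h3
    refine ⟨0, by simp, ?_⟩
    rw [h.zero, zero_sub, norm_neg, Complex.sq_norm, Complex.normSq_apply]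
    nlinarith
  | succ n ih =>
    intro z h1 h2 h3
    rcases le_total z.re (1 / 2) with h4 | h4
    · obtain ⟨t, ht, h5⟩ := ih ⟨z.re + z.im, z.re - z.im⟩ (by simpa using h2)
        (by simp only; linarith) (by simp only; linarith)
      refine ⟨t / 2, ⟨by linarith [ht.1], by linarith [ht.2]⟩, ?_⟩
      have e : z = triangleApex * star (⟨z.re + z.im, z.re - z.im⟩ : ℂ) := by
        apply Complex.ext <;> simp [triangleApex] <;> ring
      rw [h.left (t / 2) (by linarith [ht.1]) (by linarith [ht.2]), mul_div_cancel₀ t two_ne_zero]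
      nth_rw 1 [e]
      rw [← mul_sub, ← star_sub, norm_mul, norm_star, mul_pow, sq_norm_triangleApex,
        pow_succ (1 / 2 : ℝ)]
      linarith
    · obtain ⟨t, ht, h5⟩ := ih ⟨z.re - z.im, 1 - z.re - z.im⟩ (by simp only; linarith)
        (by simp only; linarith) (by simp only; linarith)
      refine ⟨(t + 1) / 2, ⟨by linarith [ht.1], by linarith [ht.2]⟩, ?_⟩
      have e : z = triangleApex
          + (1 - triangleApex) * star (⟨z.re - z.im, 1 - z.re - z.im⟩ : ℂ) := by
        apply Complex.ext <;> simp [triangleApex] <;> ring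
      have e2 : 2 * ((t + 1) / 2) - 1 = t := by ring
      rw [h.right ((t + 1) / 2) (by linarith [ht.1]) (by linarith [ht.2]), e2]
      nth_rw 1 [e]
      rw [add_sub_add_left_eq_sub, ← mul_sub, ← star_sub, norm_mul, norm_star, mul_pow,
        sq_norm_one_sub_triangleApex,
        pow_succ (1 / 2 : ℝ)]
      linarith

end IsSierpinskiCurve

/-- There is a square-filling curve that is Hölder continuous of exponent `1/2`. -/
lemma exists_holder_curve_covering_square : ∃ γ : ℝ → ℂ, Continuous γ ∧
    (∀ s t, s ≤ t → ‖γ t - γ s‖ ^ 2 ≤ 1600 * (t - s)) ∧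
    closedSquare (1 / 2) ⊆ γ '' Set.Icc 0 1 := by
  obtain ⟨γ, h⟩ := exists_isSierpinskiCurve
  let p : ℝ → ℝ := fun t => max 0 (min 1 t)
  have hp : ∀ t, p t ∈ Set.Icc (0 : ℝ) 1 := fun t => ⟨le_max_left _ _, by simp [p]⟩
  have hp' : ∀ t ∈ Set.Icc (0 : ℝ) 1, p t = t := fun t ht => by simp [p, ht.1, ht.2]
  have hmono : ∀ s t, s ≤ t → 0 ≤ p t - p s ∧ p t - p s ≤ t - s := fun s t hst => by
    simp only [p]
    rcases max_cases 0 (min 1 t) with ⟨h1, _⟩ | ⟨h1, _⟩ <;>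
    rcases max_cases 0 (min 1 s) with ⟨h2, _⟩ | ⟨h2, _⟩ <;>
    rcases min_cases 1 t with ⟨h3, _⟩ | ⟨h3, _⟩ <;>
    rcases min_cases 1 s with ⟨h4, _⟩ | ⟨h4, _⟩ <;>
    constructor <;> linarith
  -- The square of side `1 / 4` centred at `1 / 2 + i / 4` lies in the triangle; it is moved to the
  -- origin and enlarged four times, whence `1600 = 4 ^ 2 * 100`.
  let η : ℝ → ℂ := fun t => 4 * (γ (p t) - ⟨1 / 2, 1 / 4⟩)
  have hη : ∀ s t, s ≤ t → ‖η t - η s‖ ^ 2 ≤ 1600 * (t - s) := fun s t hst => by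
    have e : η t - η s = 4 * (γ (p t) - γ (p s)) := by simp only [η]; ring
    obtain ⟨h1, h2⟩ := hmono s t hst
    have := h.sq_norm_sub_le_of_le (hp s).1 (by linarith) (hp t).2
    rw [e, norm_mul, mul_pow, Complex.norm_ofNat]
    linarith
  have hc : Continuous η := by
    rw [continuous_iff_continuousAt]
    intro s
    rw [ContinuousAt, tendsto_iff_norm_sub_tendsto_zero]
    have h0 : Filter.Tendsto (fun t => Real.sqrt (1600 * |t - s|)) (nhds s) (nhds 0) := by
      have : Continuous (fun t => Real.sqrt (1600 * |t - s|)) := by fun_prop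
      simpa using this.tendsto s
    refine squeeze_zero (fun t => norm_nonneg _) (fun t => Real.le_sqrt_of_sq_le ?_) h0
    rcases le_total s t with hst | hst
    · rw [abs_of_nonneg (by linarith)]; exact hη s t hst
    · rw [abs_of_nonpos (by linarith), norm_sub_rev]
      linarith [hη t s hst]
  refine ⟨η, hc, hη, fun z hz => ?_⟩
  obtain ⟨h1, h2⟩ := hz
  rw [abs_le] at h1 h2
  -- The image of the curve is compact, so approximating `z` is enough.
  rw [← (isCompact_Icc.image hc).isClosed.closure_eq, Metric.mem_closure_iff]
  intro ε hε
  obtain ⟨n, hn⟩ := exists_pow_lt_of_lt_one (show 0 < ε ^ 2 / 32 by positivity)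
    (show (1 / 2 : ℝ) < 1 by norm_num)
  obtain ⟨t, ht, h3⟩ := h.exists_sq_norm_sub_le n (⟨1 / 2 + z.re / 4, 1 / 4 + z.im / 4⟩)
    (by simp only; linarith) (by simp only; linarith) (by simp only; linarith)
  refine ⟨η t, ⟨t, ht, rfl⟩, ?_⟩
  have e : z - η t = - (4 * (γ t - ⟨1 / 2 + z.re / 4, 1 / 4 + z.im / 4⟩)) := by
    simp only [η, hp' t ht]
    apply Complex.ext <;> simp <;> ring
  rw [dist_eq_norm, e, norm_neg, norm_mul, Complex.norm_ofNat]
  refine lt_of_pow_lt_pow_left₀ 2 hε.le ?_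
  rw [mul_pow]
  linarith

/-! ### Quantile functions and parametrization of a measure by an interval -/

lemma exists_monotone_map_restrict_eq (N : ℕ) (ν : Measure ℝ) (hN : ν Set.univ = N)
    (hν : ν (Set.Icc 0 1)ᶜ = 0) :
    ∃ q : ℝ → ℝ, MonotoneOn q (Set.Icc 0 (N : ℝ)) ∧ (∀ u ∈ Set.Icc 0 (N : ℝ), q u ∈ Set.Icc 0 1) ∧
      Measure.map q (volume.restrict (Set.Ioc 0 (N : ℝ))) = ν := by
  have : IsFiniteMeasure ν := ⟨by rw [hN]; exact ENNReal.natCast_lt_top N⟩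
  -- The infimum of `S u` is the quantile. The condition `0 ≤ t` bounds the set below, also for `u =
  -- 0`.
  let S : ℝ → Set ℝ := fun u => {t | 0 ≤ t ∧ ENNReal.ofReal u ≤ ν (Set.Iic t)}
  have hbdd : ∀ u, BddBelow (S u) := fun u => ⟨0, fun t ht => ht.1⟩
  have hF1 : ν (Set.Iic 1) = N := by
    rw [← hN]
    refine measure_congr ?_
    rw [Filter.eventuallyEq_univ, mem_ae_iff]
    refine measure_mono_null (fun t ht => ?_) hν
    simp only [Set.mem_compl_iff, Set.mem_Iic, Set.mem_Icc] at ht ⊢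
    exact fun h => ht h.2
  have hone : ∀ u ≤ (N : ℝ), (1 : ℝ) ∈ S u := fun u hu => by
    refine ⟨zero_le_one, ?_⟩
    rw [hF1, ← ENNReal.ofReal_natCast]
    exact ENNReal.ofReal_le_ofReal hu
  have hmono : MonotoneOn (fun u => sInf (S u)) (Set.Icc 0 (N : ℝ)) := fun u hu v hv huv =>
    csInf_le_csInf (hbdd u) ⟨1, hone v hv.2⟩
      fun t ht => ⟨ht.1, (ENNReal.ofReal_le_ofReal huv).trans ht.2⟩
  have hnonneg : ∀ u ∈ Set.Icc 0 (N : ℝ), 0 ≤ sInf (S u) := fun u hu =>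
    le_csInf ⟨1, hone u hu.2⟩ fun t ht => ht.1
  have hright : ∀ t, ν (Set.Iic t) = ⨅ n : ℕ, ν (Set.Iic (t + 1 / ((n : ℝ) + 1))) := fun t => by
    have e : Set.Iic t = ⋂ n : ℕ, Set.Iic (t + 1 / ((n : ℝ) + 1)) := by
      ext x
      simp only [Set.mem_Iic, Set.mem_iInter]
      refine ⟨fun h n => h.trans (le_add_of_nonneg_right (by positivity)), fun h => ?_⟩
      refine le_of_forall_pos_le_add fun ε hε => ?_
      obtain ⟨n, hn⟩ := exists_nat_one_div_lt hε
      linarith [h n]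
    rw [e]
    refine Antitone.measure_iInter (fun m n hmn => Set.Iic_subset_Iic.2 ?_)
      (fun n => measurableSet_Iic.nullMeasurableSet) ⟨0, measure_ne_top _ _⟩
    have := Nat.one_div_le_one_div (α := ℝ) hmn
    linarith
  -- The Galois connection between quantile and distribution function. It rests on right continuity;
  -- `u = 0` must be excluded because of `a < 0`.
  have key : ∀ u ∈ Set.Ioc 0 (N : ℝ), ∀ a, sInf (S u) ≤ a ↔ ENNReal.ofReal u ≤ ν (Set.Iic a) := by
    intro u hu a
    have hu' : u ∈ Set.Icc 0 (N : ℝ) := ⟨hu.1.le, hu.2⟩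
    rcases lt_or_ge a 0 with ha | ha
    · have h0 : ν (Set.Iic a) = 0 := measure_mono_null
        (show Set.Iic a ⊆ (Set.Icc 0 1)ᶜ from fun t ht h => by
          linarith [h.1, Set.mem_Iic.1 ht]) hν
      rw [h0, nonpos_iff_eq_zero, ENNReal.ofReal_eq_zero]
      exact ⟨fun h => absurd (hnonneg u hu') (by linarith), fun h => absurd hu.1 (by linarith)⟩
    · refine ⟨fun h => ?_, fun h => csInf_le (hbdd u) ⟨ha, h⟩⟩
      rw [hright]
      refine le_iInf fun n => ?_
      obtain ⟨t, ht, hlt⟩ := exists_lt_of_csInf_lt (s := S u) ⟨1, hone u hu.2⟩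
        (h.trans_lt (lt_add_of_pos_right a (show (0 : ℝ) < 1 / ((n : ℝ) + 1) by positivity)))
      exact ht.2.trans (measure_mono (Set.Iic_subset_Iic.2 hlt.le))
  refine ⟨fun u => sInf (S u), hmono, fun u hu => ⟨hnonneg u hu, csInf_le (hbdd u) (hone u hu.2)⟩,
    ?_⟩
  symm
  refine Measure.ext_of_Iic _ _ fun a => ?_
  have hfin : ν (Set.Iic a) ≠ ⊤ := measure_ne_top _ _
  have hle : (ν (Set.Iic a)).toReal ≤ N := by
    have := ENNReal.toReal_mono (ENNReal.natCast_ne_top N)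
      ((measure_mono (Set.subset_univ (Set.Iic a))).trans hN.le)
    simpa using this
  rw [Measure.map_apply_of_aemeasurable (aemeasurable_restrict_of_monotoneOn measurableSet_Ioc
    (hmono.mono Set.Ioc_subset_Icc_self)) measurableSet_Iic,
    Measure.restrict_apply' measurableSet_Ioc]
  have e : (fun u => sInf (S u)) ⁻¹' Set.Iic a ∩ Set.Ioc 0 (N : ℝ)
      = Set.Ioc 0 (ν (Set.Iic a)).toReal := by
    ext u
    constructor
    · rintro ⟨h1, h2⟩
      exact ⟨h2.1, (ENNReal.ofReal_le_iff_le_toReal hfin).1 ((key u h2 a).1 h1)⟩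
    · rintro ⟨h1, h2⟩
      have h3 : u ∈ Set.Ioc 0 (N : ℝ) := ⟨h1, h2.trans hle⟩
      exact ⟨(key u h3 a).2 ((ENNReal.ofReal_le_iff_le_toReal hfin).2 h2), h3⟩
  rw [e, Real.volume_Ioc, sub_zero, ENNReal.ofReal_toReal hfin]

/-- Take the first time at which `γ` visits `z`. Its sublevel sets are compact images of initial
arcs, together with the complement of the curve, where `sInf ∅ = 0`. -/
lemma exists_measurable_section {γ : ℝ → ℂ} (hγ : Continuous γ) :
    ∃ s : ℂ → ℝ, Measurable s ∧ (∀ z, s z ∈ Set.Icc 0 1) ∧ ∀ z ∈ γ '' Set.Icc 0 1, γ (s z) = z := by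
  have hcpt : ∀ z, IsCompact (Set.Icc 0 1 ∩ γ ⁻¹' {z}) := fun z =>
    isCompact_Icc.inter_right (isClosed_singleton.preimage hγ)
  have hmem : ∀ z ∈ γ '' Set.Icc 0 1, sInf (Set.Icc 0 1 ∩ γ ⁻¹' {z}) ∈ Set.Icc 0 1 ∩ γ ⁻¹' {z} := by
    rintro z ⟨t, ht, rfl⟩
    exact (hcpt _).sInf_mem ⟨t, ht, rfl⟩
  have hnot : ∀ z, z ∉ γ '' Set.Icc 0 1 → sInf (Set.Icc 0 1 ∩ γ ⁻¹' {z}) = 0 := fun z hz => by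
    have : Set.Icc 0 1 ∩ γ ⁻¹' {z} = ∅ :=
      Set.eq_empty_of_forall_notMem fun t ht => hz ⟨t, ht.1, ht.2⟩
    rw [this, Real.sInf_empty]
  have hIcc : ∀ z, sInf (Set.Icc 0 1 ∩ γ ⁻¹' {z}) ∈ Set.Icc (0 : ℝ) 1 := fun z => by
    by_cases hz : z ∈ γ '' Set.Icc 0 1
    · exact (hmem z hz).1
    · rw [hnot z hz]; simp
  refine ⟨fun z => sInf (Set.Icc 0 1 ∩ γ ⁻¹' {z}), measurable_of_Iic fun a => ?_, hIcc,
    fun z hz => (hmem z hz).2⟩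
  rcases lt_or_ge a 0 with ha | ha
  · have : (fun z => sInf (Set.Icc 0 1 ∩ γ ⁻¹' {z})) ⁻¹' Set.Iic a = ∅ :=
      Set.eq_empty_of_forall_notMem fun z hz => by
        linarith [(hIcc z).1, show sInf (Set.Icc 0 1 ∩ γ ⁻¹' {z}) ≤ a from hz]
    rw [this]
    exact MeasurableSet.empty
  · have : (fun z => sInf (Set.Icc 0 1 ∩ γ ⁻¹' {z})) ⁻¹' Set.Iic a
        = γ '' (Set.Icc 0 1 ∩ Set.Iic a) ∪ (γ '' Set.Icc 0 1)ᶜ := by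
      ext z
      simp only [Set.mem_preimage, Set.mem_Iic, Set.mem_union, Set.mem_compl_iff]
      constructor
      · intro h
        by_cases hz : z ∈ γ '' Set.Icc 0 1
        · exact Or.inl ⟨_, ⟨(hmem z hz).1, h⟩, (hmem z hz).2⟩
        · exact Or.inr hz
      · rintro (⟨t, ⟨ht, hta⟩, rfl⟩ | hz)
        · exact (csInf_le (hcpt _).bddBelow ⟨ht, rfl⟩).trans hta
        · rw [hnot z hz]; exact ha
    rw [this]
    exact ((isCompact_Icc.inter_right isClosed_Iic).image hγ).isClosed.measurableSet.union
      (isCompact_Icc.image hγ).isClosed.measurableSet.compl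

/-- A measure of mass `N` carried by a curve `γ` is parametrized by `(0, N]` along `γ`. -/
lemma exists_monotone_map_comp_eq {γ : ℝ → ℂ} (hγ : Continuous γ) (N : ℕ) (μ : Measure ℂ)
    (hN : μ Set.univ = N) (hμ : μ (γ '' Set.Icc 0 1)ᶜ = 0) :
    ∃ q : ℝ → ℝ, Monotone q ∧ (∀ u ∈ Set.Icc 0 (N : ℝ), q u ∈ Set.Icc 0 1) ∧
      Measure.map (γ ∘ q) (volume.restrict (Set.Ioc 0 (N : ℝ))) = μ := by
  obtain ⟨s, hs, hs1, hs2⟩ := exists_measurable_section hγ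
  obtain ⟨q, hq1, hq2, hq3⟩ := exists_monotone_map_restrict_eq N (μ.map s)
    (by rw [Measure.map_apply hs MeasurableSet.univ, Set.preimage_univ, hN])
    (by
      rw [Measure.map_apply hs measurableSet_Icc.compl]
      exact measure_mono_null (fun z hz => absurd (hs1 z) hz) measure_empty)
  -- Monotonicity on all of `ℝ` makes the parametrization Borel measurable.
  obtain ⟨p, hp1, hp2⟩ := hq1.exists_monotone_extension
    ⟨0, by rintro _ ⟨u, hu, rfl⟩; exact (hq2 u hu).1⟩
    ⟨1, by rintro _ ⟨u, hu, rfl⟩; exact (hq2 u hu).2⟩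
  refine ⟨p, hp1, fun u hu => hp2 hu ▸ hq2 u hu, ?_⟩
  have hpq : p =ᵐ[volume.restrict (Set.Ioc 0 (N : ℝ))] q := by
    filter_upwards [self_mem_ae_restrict measurableSet_Ioc] with u hu
    exact (hp2 (Set.Ioc_subset_Icc_self hu)).symm
  rw [← Measure.map_map hγ.measurable hp1.measurable, Measure.map_congr hpq, hq3,
    Measure.map_map hγ.measurable hs]
  have : γ ∘ s =ᵐ[μ] id := by
    filter_upwards [compl_mem_ae_iff.2 hμ] with z hz
    exact hs2 z (not_not.1 hz)
  rw [Measure.map_congr this, Measure.map_id]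

/-! ### The remainder of the second order expansion of the logarithmic kernel -/

/-- Real part of the second order Taylor formula for `log (1 + x)` at `x = -(w / z)`. -/
lemma abs_log_norm_sub_sub_le {z w : ℂ} (hz : z ≠ 0) (hw : ‖w‖ ≤ ‖z‖ / 2) :
    |Real.log ‖z - w‖ - (Real.log ‖z‖ - (z⁻¹ * w + (2 * z ^ 2)⁻¹ * w ^ 2).re)|
      ≤ (‖w‖ / ‖z‖) ^ 3 := by
  have hz' : 0 < ‖z‖ := norm_pos_iff.2 hz
  set x : ℂ := -(w / z) with hx
  have hxn : ‖x‖ = ‖w‖ / ‖z‖ := by rw [hx, norm_neg, norm_div]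
  have hx2 : ‖x‖ ≤ 1 / 2 := by
    rw [hxn, div_le_iff₀ hz']; linarith
  have h1 : 1 + x ≠ 0 := fun h => by
    have : x = -1 := by linear_combination h
    rw [this] at hx2
    norm_num at hx2
  have e : z - w = z * (1 + x) := by rw [hx]; field_simp; ring
  have h2 := Complex.norm_log_sub_logTaylor_le 2 (z := x) (by linarith)
  have h3 : Complex.logTaylor (2 + 1) x = -(z⁻¹ * w + (2 * z ^ 2)⁻¹ * w ^ 2) := by
    simp only [Complex.logTaylor_succ, Complex.logTaylor_zero, hx]
    push_cast
    norm_num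
    field_simp
    ring
  have h4 := (Complex.abs_re_le_norm _).trans h2
  rw [Complex.sub_re, Complex.log_re, h3, Complex.neg_re] at h4
  rw [e, norm_mul, Real.log_mul hz'.ne' (norm_ne_zero_iff.2 h1), ← hxn]
  have h5 : ‖x‖ ^ (2 + 1) * (1 - ‖x‖)⁻¹ / ((2 : ℕ) + 1 : ℝ) ≤ ‖x‖ ^ 3 := by
    have h6 : (1 - ‖x‖)⁻¹ ≤ 2 := by
      rw [inv_le_comm₀ (by linarith) two_pos]; linarith
    have h7 : (0 : ℝ) ≤ ‖x‖ ^ 3 := by positivity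
    rw [div_le_iff₀ (by positivity)]
    push_cast
    nlinarith
  refine le_trans (le_of_eq ?_) (h4.trans h5)
  congr 1
  ring

/-- The part of the logarithmic kernel `log ‖z - w‖` that is determined by the moments of order at
most two in `w`: the constant `log d` near the origin and the Taylor polynomial far from it. -/
noncomputable def logTaylorPart (d : ℝ) (z w : ℂ) : ℝ :=
  if ‖z‖ ≤ 6 * d then Real.log d
  else Real.log ‖z‖ - (z⁻¹ * w + (2 * z ^ 2)⁻¹ * w ^ 2).re

noncomputable def logRemainder (d : ℝ) (z w : ℂ) : ℝ :=
  Real.log ‖z - w‖ - logTaylorPart d z w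

/-- The radius is `9 = 6 + 3`: `‖z‖ ≤ 6 * d` and `‖w‖ ≤ 3 * d` force `‖z - w‖ ≤ 9 * d`. -/
noncomputable def truncatedAbsLog (x : ℂ) : ℝ := if ‖x‖ ≤ 9 then |Real.log ‖x‖| else 0

lemma abs_logRemainder_le {d : ℝ} (hd : 0 < d) {z w : ℂ} (hw : ‖w‖ ≤ 3 * d) (hzw : z ≠ w) :
    |logRemainder d z w| ≤
      truncatedAbsLog (d⁻¹ • (z - w)) + 54 * (1 + ‖d⁻¹ • z‖) ^ (-3 : ℝ) := by
  have hG : 0 ≤ (1 + ‖d⁻¹ • z‖) ^ (-3 : ℝ) := by positivity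
  have hF : 0 ≤ truncatedAbsLog (d⁻¹ • (z - w)) := by
    unfold truncatedAbsLog; split_ifs <;> positivity
  have hn : ∀ x : ℂ, ‖d⁻¹ • x‖ = ‖x‖ / d := fun x => by
    rw [norm_smul, norm_inv, Real.norm_eq_abs, abs_of_pos hd, inv_mul_eq_div]
  unfold logRemainder logTaylorPart
  split_ifs with h
  · have h1 : ‖z - w‖ / d ≤ 9 := by
      rw [div_le_iff₀ hd]; linarith [norm_sub_le z w]
    rw [truncatedAbsLog, hn, if_pos h1, Real.log_div (norm_ne_zero_iff.2 (sub_ne_zero.2 hzw)) hd.ne']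
    linarith
  · push Not at h
    have hz : 0 < ‖z‖ := by linarith
    refine (abs_log_norm_sub_sub_le (norm_pos_iff.1 hz) (by linarith)).trans ?_
    refine le_trans ?_ (le_add_of_nonneg_left hF)
    rw [hn, Real.rpow_neg (by positivity), show (3 : ℝ) = (3 : ℕ) by norm_num, Real.rpow_natCast,
      ← inv_pow]
    -- Since `d < ‖z‖ / 6`, the sum `d + ‖z‖` is at most `7 / 6 * ‖z‖`, and `3 * (7 / 6) = 7 / 2`.
    have h2 : ‖w‖ / ‖z‖ ≤ 7 / 2 * (1 + ‖z‖ / d)⁻¹ := by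
      have : 1 + ‖z‖ / d = (d + ‖z‖) / d := by field_simp
      rw [this, inv_div, ← mul_div_assoc, div_le_div_iff₀ hz (by positivity)]
      nlinarith
    have h3 : (0 : ℝ) ≤ (1 + ‖z‖ / d)⁻¹ ^ 3 := by positivity
    calc (‖w‖ / ‖z‖) ^ 3 ≤ (7 / 2 * (1 + ‖z‖ / d)⁻¹) ^ 3 := by gcongr
      _ = 343 / 8 * (1 + ‖z‖ / d)⁻¹ ^ 3 := by ring
      _ ≤ 54 * (1 + ‖z‖ / d)⁻¹ ^ 3 := by nlinarith

lemma measurable_truncatedAbsLog : Measurable truncatedAbsLog := by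
  refine Measurable.ite (measurableSet_le measurable_norm measurable_const) ?_ measurable_const
  exact (Real.measurable_log.comp measurable_norm).abs

lemma lintegral_truncatedAbsLog_lt_top : ∫⁻ x, ‖truncatedAbsLog x‖ₑ < ⊤ := by
  have h : IntegrableOn (fun x : ℂ => |Real.log ‖x‖|) (Metric.ball 0 10) := by
    rw [integrableOn_fun_norm_addHaar volume (f := fun r => |Real.log r|)]
    have h1 : IntegrableOn Real.log (Set.Ioo 0 10) :=
      (intervalIntegral.intervalIntegrable_log' (a := 0) (b := 10)).1.mono_set
        Set.Ioo_subset_Ioc_self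
    simp only [Complex.finrank_real_complex, smul_eq_mul]
    refine Integrable.mono' (h1.abs.const_mul 10) ?_ ?_
    · exact (by fun_prop : Measurable fun y : ℝ => y ^ (2 - 1) * |Real.log y|).aestronglyMeasurable
    · filter_upwards [self_mem_ae_restrict measurableSet_Ioo] with y hy
      rw [Real.norm_eq_abs, abs_mul, abs_abs]
      have : |y ^ (2 - 1)| ≤ 10 := by
        rw [show 2 - 1 = 1 from rfl, pow_one, abs_of_pos hy.1]; exact hy.2.le
      gcongr
  refine lt_of_le_of_lt ?_ h.2
  rw [← lintegral_indicator Metric.isOpen_ball.measurableSet]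
  refine lintegral_mono fun x => ?_
  by_cases hx : ‖x‖ ≤ 9
  · rw [Set.indicator_of_mem (by rw [mem_ball_zero_iff]; linarith), truncatedAbsLog, if_pos hx]
  · rw [truncatedAbsLog, if_neg hx]; simp

lemma lintegral_comp_inv_smul {f : ℂ → ENNReal} (hf : Measurable f) {d : ℝ} (hd : 0 < d) :
    ∫⁻ z, f (d⁻¹ • z) = ENNReal.ofReal (d ^ 2) * ∫⁻ z, f z := by
  have h := lintegral_map (μ := volume) hf 
    (measurable_const_smul (d⁻¹ : ℝ) : Measurable fun z : ℂ => d⁻¹ • z)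
  rw [← h, Measure.map_addHaar_smul _ (inv_ne_zero hd.ne'), lintegral_smul_measure,
    Complex.finrank_real_complex, inv_pow, inv_inv, abs_of_pos (by positivity), smul_eq_mul]

/-- The majorant is a function of `z / d`, up to a translation, and it is integrable because `3`
exceeds the dimension `2`. The change of variables produces `d ^ 2`. -/
lemma exists_lintegral_logRemainder_le : ∃ A : NNReal, ∀ d : ℝ, 0 < d → ∀ w : ℂ, ‖w‖ ≤ 3 * d →
    ∫⁻ z, ‖logRemainder d z w‖ₑ ≤ A * ENNReal.ofReal (d ^ 2) := by
  let G : ℂ → ℝ := fun x => 54 * (1 + ‖x‖) ^ (-3 : ℝ)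
  have hGi : Integrable G := (integrable_one_add_norm (by
    rw [Complex.finrank_real_complex]; norm_num)).const_mul 54
  have hGm : Measurable G := by fun_prop
  have hfin : (∫⁻ x, ‖truncatedAbsLog x‖ₑ) + ∫⁻ x, ‖G x‖ₑ ≠ ⊤ :=
    (ENNReal.add_lt_top.2 ⟨lintegral_truncatedAbsLog_lt_top, hGi.2⟩).ne
  refine ⟨((∫⁻ x, ‖truncatedAbsLog x‖ₑ) + ∫⁻ x, ‖G x‖ₑ).toNNReal, fun d hd w hw => ?_⟩
  rw [ENNReal.coe_toNNReal hfin, mul_comm, mul_add,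
    ← lintegral_comp_inv_smul measurable_truncatedAbsLog.enorm hd,
    ← lintegral_comp_inv_smul hGm.enorm hd,
    ← lintegral_sub_right_eq_self (fun z : ℂ => ‖truncatedAbsLog (d⁻¹ • z)‖ₑ) w,
    ← lintegral_add_right _ (by fun_prop : Measurable fun z : ℂ => ‖G (d⁻¹ • z)‖ₑ)]
  refine lintegral_mono_ae ?_
  filter_upwards [compl_mem_ae_iff.2 (measure_singleton w)] with z hz
  have h := abs_logRemainder_le hd hw hz
  refine le_trans ?_ (enorm_add_le _ _)
  rw [Real.enorm_eq_ofReal_abs, Real.enorm_eq_ofReal_abs]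
  exact ENNReal.ofReal_le_ofReal (h.trans (le_abs_self _))

lemma measurable_logTaylorPart (d : ℝ) : Measurable fun p : ℂ × ℂ => logTaylorPart d p.1 p.2 := by
  refine Measurable.ite (measurableSet_le measurable_fst.norm measurable_const) measurable_const ?_
  fun_prop

lemma measurable_logRemainder (d : ℝ) : Measurable fun p : ℂ × ℂ => logRemainder d p.1 p.2 := by
  refine Measurable.sub ?_ (measurable_logTaylorPart d)
  fun_prop

/-! ### Replacing a measure of mass two by two point masses -/

/-- A constant bounding the integral of the remainder of the logarithmic kernel. -/
noncomputable def logRemainderBound : NNReal := exists_lintegral_logRemainder_le.choose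

lemma lintegral_logRemainder_le {d : ℝ} (hd : 0 < d) {w : ℂ} (hw : ‖w‖ ≤ 3 * d) (c : ℂ) :
    ∫⁻ z, ‖logRemainder d (z - c) w‖ₑ ≤ logRemainderBound * ENNReal.ofReal (d ^ 2) := by
  rw [lintegral_sub_right_eq_self (fun z : ℂ => ‖logRemainder d z w‖ₑ) c]
  exact exists_lintegral_logRemainder_le.choose_spec d hd w hw

lemma lintegral_lintegral_logRemainder_le (ν : Measure ℂ) [IsFiniteMeasure ν] {d : ℝ} (hd : 0 < d)
    {c : ℂ} (hν : ∀ᵐ ζ ∂ν, ‖ζ - c‖ ≤ 3 * d) :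
    ∫⁻ z, ∫⁻ ζ, ‖logRemainder d (z - c) (ζ - c)‖ₑ ∂ν
      ≤ logRemainderBound * ENNReal.ofReal (d ^ 2) * ν Set.univ := by
  have hm : Measurable fun p : ℂ × ℂ => ‖logRemainder d (p.1 - c) (p.2 - c)‖ₑ :=
    ((measurable_logRemainder d).comp
      ((measurable_fst.sub_const c).prodMk (measurable_snd.sub_const c))).enorm
  rw [lintegral_lintegral_swap hm.aemeasurable, ← lintegral_const]
  refine lintegral_mono_ae ?_
  filter_upwards [hν] with ζ hζ
  exact lintegral_logRemainder_le hd hζ c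

lemma measurable_logRemainder_sub (d : ℝ) (c z : ℂ) :
    Measurable fun ζ => logRemainder d (z - c) (ζ - c) :=
  (measurable_logRemainder d).comp (measurable_const.prodMk (measurable_id.sub_const c))

lemma ae_integrable_logRemainder (ν : Measure ℂ) [IsFiniteMeasure ν] {d : ℝ} (hd : 0 < d)
    {c : ℂ} (hν : ∀ᵐ ζ ∂ν, ‖ζ - c‖ ≤ 3 * d) :
    ∀ᵐ z, Integrable (fun ζ => logRemainder d (z - c) (ζ - c)) ν := by
  have hm : Measurable fun p : ℂ × ℂ => ‖logRemainder d (p.1 - c) (p.2 - c)‖ₑ :=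
    ((measurable_logRemainder d).comp
      ((measurable_fst.sub_const c).prodMk (measurable_snd.sub_const c))).enorm
  have hlt := (lintegral_lintegral_logRemainder_le ν hd hν).trans_lt (ENNReal.mul_lt_top
    (ENNReal.mul_lt_top ENNReal.coe_lt_top ENNReal.ofReal_lt_top) (measure_lt_top ν _))
  filter_upwards [ae_lt_top hm.lintegral_prod_right' hlt.ne] with z hz
  exact ⟨(measurable_logRemainder_sub d c z).aestronglyMeasurable, hz⟩

lemma integrable_pow_sub {ν : Measure ℂ} [IsFiniteMeasure ν] {r : ℝ}
    {c : ℂ} (hν : ∀ᵐ ζ ∂ν, ‖ζ - c‖ ≤ r) (n : ℕ) : Integrable (fun ζ => (ζ - c) ^ n) ν := by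
  refine Integrable.of_bound (by fun_prop : Measurable fun ζ => (ζ - c) ^ n).aestronglyMeasurable
    (r ^ n) ?_
  filter_upwards [hν] with ζ hζ
  rw [norm_pow]
  gcongr

lemma integrable_quadratic {ν : Measure ℂ} [IsFiniteMeasure ν] {r : ℝ}
    {c : ℂ} (hν : ∀ᵐ ζ ∂ν, ‖ζ - c‖ ≤ r) (a b : ℂ) :
    Integrable (fun ζ => a * (ζ - c) + b * (ζ - c) ^ 2) ν := by
  have h1 := integrable_pow_sub hν 1
  simp only [pow_one] at h1
  exact (h1.const_mul a).add ((integrable_pow_sub hν 2).const_mul b)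

lemma integrable_logTaylorPart {ν : Measure ℂ} [IsFiniteMeasure ν] {r : ℝ}
    {c : ℂ} (hν : ∀ᵐ ζ ∂ν, ‖ζ - c‖ ≤ r) (d : ℝ) (z : ℂ) :
    Integrable (fun ζ => logTaylorPart d z (ζ - c)) ν := by
  unfold logTaylorPart
  split_ifs
  · exact integrable_const _
  · exact (integrable_const _).sub (integrable_quadratic hν _ _).re

lemma integral_logTaylorPart {ν : Measure ℂ} [IsFiniteMeasure ν] {r : ℝ} {c : ℂ}
    (hν : ∀ᵐ ζ ∂ν, ‖ζ - c‖ ≤ r) (hmass : ν.real Set.univ = 2) {x y : ℂ}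
    (h1 : ∫ ζ, (ζ - c) ∂ν = x + y) (h2 : ∫ ζ, (ζ - c) ^ 2 ∂ν = x ^ 2 + y ^ 2) (d : ℝ) (z : ℂ) :
    ∫ ζ, logTaylorPart d z (ζ - c) ∂ν = logTaylorPart d z x + logTaylorPart d z y := by
  unfold logTaylorPart
  split_ifs
  · rw [integral_const, hmass, smul_eq_mul, two_mul]
  · have hi := integrable_pow_sub hν 1
    simp only [pow_one] at hi
    have hre := integral_re (integrable_quadratic hν z⁻¹ (2 * z ^ 2)⁻¹)
    simp only [RCLike.re_to_complex] at hre
    have hq := (integrable_quadratic hν z⁻¹ (2 * z ^ 2)⁻¹).re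
    simp only [RCLike.re_to_complex] at hq
    rw [integral_sub (integrable_const _) hq, integral_const, hmass, hre,
      integral_add (hi.const_mul _) ((integrable_pow_sub hν 2).const_mul _),
      integral_const_mul, integral_const_mul, h1, h2, smul_eq_mul]
    simp only [mul_add, Complex.add_re]
    ring

lemma ae_integrable_log_norm_sub (ν : Measure ℂ) [IsFiniteMeasure ν] {d : ℝ} (hd : 0 < d)
    {c : ℂ} (hν : ∀ᵐ ζ ∂ν, ‖ζ - c‖ ≤ 3 * d) :
    ∀ᵐ z, Integrable (fun ζ => Real.log ‖z - ζ‖) ν := by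
  filter_upwards [ae_integrable_logRemainder ν hd hν] with z hz
  refine (hz.add (integrable_logTaylorPart hν d (z - c))).congr ?_
  filter_upwards with ζ
  simp only [Pi.add_apply, logRemainder, sub_sub_sub_cancel_right, sub_add_cancel]

/-- Take `(a ± s) / 2` with `s ^ 2 = 2 * b - a ^ 2`; then `‖s‖ ^ 2 ≤ 8 * d ^ 2`. The two points may
leave the disc of radius `d`, which is why the kernel estimates allow `3 * d`. -/
lemma exists_sum_eq_sum_sq_eq {d : ℝ} (hd : 0 ≤ d) {a b : ℂ} (ha : ‖a‖ ≤ 2 * d)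
    (hb : ‖b‖ ≤ 2 * d ^ 2) :
    ∃ x y : ℂ, x + y = a ∧ x ^ 2 + y ^ 2 = b ∧ ‖x‖ ≤ 3 * d ∧ ‖y‖ ≤ 3 * d := by
  obtain ⟨s, hs⟩ := IsAlgClosed.exists_pow_nat_eq (2 * b - a ^ 2) two_pos
  have hs' : ‖s‖ ≤ 3 * d := by
    refine abs_le_of_sq_le_sq' ?_ (by positivity) |>.2
    rw [← norm_pow, hs]
    refine (norm_sub_le _ _).trans ?_
    rw [norm_mul, norm_pow, Complex.norm_ofNat]
    nlinarith [norm_nonneg a]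
  refine ⟨(a + s) / 2, (a - s) / 2, by ring, by linear_combination (1 / 2 : ℂ) * hs, ?_, ?_⟩
  · rw [norm_div, Complex.norm_ofNat]
    linarith [norm_add_le a s]
  · rw [norm_div, Complex.norm_ofNat]
    linarith [norm_sub_le a s]

/-- A measure of mass two carried by a disc of radius `d` can be replaced by two point masses, with
an `L¹` error of order `d ^ 2` between the logarithmic potentials. -/
lemma exists_two_points_lintegral_le (ν : Measure ℂ) (hmass : ν Set.univ = 2) {d : ℝ} (hd : 0 < d)
    {c : ℂ} (hν : ∀ᵐ ζ ∂ν, ‖ζ - c‖ ≤ d) :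
    ∃ x y : ℂ, ∫⁻ z, ‖∫ ζ, Real.log ‖z - ζ‖ ∂ν - (Real.log ‖z - x‖ + Real.log ‖z - y‖)‖ₑ
      ≤ 4 * logRemainderBound * ENNReal.ofReal (d ^ 2) := by
  have : IsFiniteMeasure ν := ⟨by rw [hmass]; exact ENNReal.ofNat_lt_top⟩
  have hreal : ν.real Set.univ = 2 := by rw [measureReal_def, hmass]; rfl
  have hν3 : ∀ᵐ ζ ∂ν, ‖ζ - c‖ ≤ 3 * d := hν.mono fun ζ h => h.trans (by linarith)
  obtain ⟨x, y, h1, h2, hx, hy⟩ := exists_sum_eq_sum_sq_eq hd.le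
    (a := ∫ ζ, (ζ - c) ∂ν) (b := ∫ ζ, (ζ - c) ^ 2 ∂ν)
    ((norm_integral_le_of_norm_le_const hν).trans (by rw [hreal, mul_comm]))
    ((norm_integral_le_of_norm_le_const (hν.mono fun ζ h => by
      rw [norm_pow]; exact pow_le_pow_left₀ (norm_nonneg _) h 2)).trans
        (by rw [hreal, mul_comm]))
  refine ⟨c + x, c + y, ?_⟩
  have hmx : ∀ w, Measurable fun z => ‖logRemainder d (z - c) w‖ₑ := fun w =>
    ((measurable_logRemainder d).comp ((measurable_id.sub_const c).prodMk measurable_const)).enorm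
  calc ∫⁻ z, ‖∫ ζ, Real.log ‖z - ζ‖ ∂ν - (Real.log ‖z - (c + x)‖ + Real.log ‖z - (c + y)‖)‖ₑ
      ≤ ∫⁻ z, ((∫⁻ ζ, ‖logRemainder d (z - c) (ζ - c)‖ₑ ∂ν) +
          (‖logRemainder d (z - c) x‖ₑ + ‖logRemainder d (z - c) y‖ₑ)) := by
        refine lintegral_mono_ae ?_
        filter_upwards [ae_integrable_logRemainder ν hd hν3] with z hz
        have e1 : ∫ ζ, Real.log ‖z - ζ‖ ∂ν = ∫ ζ, logRemainder d (z - c) (ζ - c) ∂ν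
            + (logTaylorPart d (z - c) x + logTaylorPart d (z - c) y) := by
          rw [← integral_logTaylorPart hν hreal h1.symm h2.symm,
            ← integral_add hz (integrable_logTaylorPart hν d (z - c))]
          simp only [logRemainder, sub_sub_sub_cancel_right, sub_add_cancel]
        have e2 : ∀ w, Real.log ‖z - (c + w)‖ = logRemainder d (z - c) w
            + logTaylorPart d (z - c) w := fun w => by
          rw [logRemainder, sub_add_cancel, sub_sub]
        -- The Taylor parts cancel by equality of the moments; only remainders survive.
        have e3 : ∫ ζ, Real.log ‖z - ζ‖ ∂ν - (Real.log ‖z - (c + x)‖ + Real.log ‖z - (c + y)‖)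
            = ∫ ζ, logRemainder d (z - c) (ζ - c) ∂ν
              - (logRemainder d (z - c) x + logRemainder d (z - c) y) := by
          rw [e1, e2, e2]; ring
        rw [e3]
        exact (enorm_sub_le).trans (add_le_add (enorm_integral_le_lintegral_enorm _)
          (enorm_add_le _ _))
    _ = (∫⁻ z, ∫⁻ ζ, ‖logRemainder d (z - c) (ζ - c)‖ₑ ∂ν) +
          ((∫⁻ z, ‖logRemainder d (z - c) x‖ₑ) + ∫⁻ z, ‖logRemainder d (z - c) y‖ₑ) := by
        rw [lintegral_add_right _ (by have := hmx x; have := hmx y; fun_prop),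
          lintegral_add_right _ (hmx y)]
    _ ≤ logRemainderBound * ENNReal.ofReal (d ^ 2) * 2 +
          (logRemainderBound * ENNReal.ofReal (d ^ 2)
            + logRemainderBound * ENNReal.ofReal (d ^ 2)) := by
        rw [← hmass]
        exact add_le_add (lintegral_lintegral_logRemainder_le ν hd hν3)
          (add_le_add (lintegral_logRemainder_le hd hx c) (lintegral_logRemainder_le hd hy c))
    _ = 4 * logRemainderBound * ENNReal.ofReal (d ^ 2) := by ring

lemma measurableSet_closedSquare (a : ℝ) : MeasurableSet (closedSquare a) :=
  (measurableSet_le Complex.measurable_re.abs measurable_const).inter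
    (measurableSet_le Complex.measurable_im.abs measurable_const)

/-- The logarithmic potential of a measure carried by the disc of radius `3` is bounded in `L¹`. -/
lemma setLIntegral_integral_log_le (ν : Measure ℂ) [IsFiniteMeasure ν] (hν : ∀ᵐ ζ ∂ν, ‖ζ‖ ≤ 3) :
    ∫⁻ z in closedSquare 1, ‖∫ ζ, Real.log ‖z - ζ‖ ∂ν‖ₑ ≤ logRemainderBound * ν Set.univ := by
  have h := lintegral_lintegral_logRemainder_le ν one_pos (c := 0) (by simpa using hν)
  simp only [one_pow, ENNReal.ofReal_one, mul_one, sub_zero] at h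
  refine le_trans ?_ ((setLIntegral_le_lintegral (closedSquare 1) _).trans h)
  refine setLIntegral_mono' ?_ fun z hz => ?_
  · exact measurableSet_closedSquare 1
  -- For `d = 1` the Taylor part on this square is `log 1 = 0`, so the remainder is the kernel
  -- itself.
  · have hz6 : ‖z‖ ≤ 6 * 1 := (Complex.norm_le_abs_re_add_abs_im z).trans (by
      linarith [hz.1, hz.2])
    refine (enorm_integral_le_lintegral_enorm _).trans_eq ?_
    simp only [logRemainder, logTaylorPart, if_pos hz6, Real.log_one, sub_zero]

/-! ### The logarithmic potential as a real integral -/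

lemma logAbs_of_ne_zero {w : ℂ} (hw : w ≠ 0) : logAbs w = (Real.log ‖w‖ : ℝ) := by
  rw [logAbs, ENNReal.log_pos_real (enorm_ne_zero.2 hw) enorm_ne_top, toReal_enorm]

lemma logPotential_eq_integral {μ : Measure ℂ} {z : ℂ} (hz : ∀ᵐ ζ ∂μ, z ≠ ζ)
    (hi : Integrable (fun ζ => Real.log ‖z - ζ‖) μ) :
    logPotential μ z = (∫ ζ, Real.log ‖z - ζ‖ ∂μ : ℝ) := by
  have hpos : ∫⁻ ζ, (logAbs (z - ζ)).toENNReal ∂μ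
      = ∫⁻ ζ, ENNReal.ofReal (Real.log ‖z - ζ‖) ∂μ := by
    refine lintegral_congr_ae ?_
    filter_upwards [hz] with ζ hζ
    rw [logAbs_of_ne_zero (sub_ne_zero.2 hζ), EReal.toENNReal_of_ne_top (EReal.coe_ne_top _),
      EReal.toReal_coe]
  have hneg : ∫⁻ ζ, (-logAbs (z - ζ)).toENNReal ∂μ
      = ∫⁻ ζ, ENNReal.ofReal (-Real.log ‖z - ζ‖) ∂μ := by
    refine lintegral_congr_ae ?_
    filter_upwards [hz] with ζ hζ
    rw [logAbs_of_ne_zero (sub_ne_zero.2 hζ), ← EReal.coe_neg,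
      EReal.toENNReal_of_ne_top (EReal.coe_ne_top _), EReal.toReal_coe]
  have hfp : ∫⁻ ζ, ENNReal.ofReal (Real.log ‖z - ζ‖) ∂μ ≠ ⊤ :=
    ((lintegral_mono fun ζ => Real.ofReal_le_enorm _).trans_lt hi.2).ne
  have hfn : ∫⁻ ζ, ENNReal.ofReal (-Real.log ‖z - ζ‖) ∂μ ≠ ⊤ :=
    ((lintegral_mono fun ζ => Real.ofReal_le_enorm _).trans_lt hi.neg.2).ne
  rw [logPotential, hpos, hneg, integral_eq_lintegral_pos_part_sub_lintegral_neg_part hi,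
    EReal.coe_sub, EReal.coe_ennreal_toReal hfp, EReal.coe_ennreal_toReal hfn]

/-- The measure may have atoms, but after exchanging the quantifiers only the Lebesgue nullity of
points is needed. -/
lemma ae_ae_ne (μ : Measure ℂ) [IsFiniteMeasure μ] : ∀ᵐ z : ℂ, ∀ᵐ ζ ∂μ, z ≠ ζ := by
  rw [Measure.ae_ae_comm measurableSet_diagonal.compl]
  filter_upwards with ζ
  exact compl_mem_ae_iff.2 (measure_singleton ζ)

lemma measurable_integral_log (ν : Measure ℂ) [IsFiniteMeasure ν] :
    Measurable fun z => ∫ ζ, Real.log ‖z - ζ‖ ∂ν := by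
  have : StronglyMeasurable fun p : ℂ × ℂ => Real.log ‖p.1 - p.2‖ :=
    (by fun_prop : Measurable fun p : ℂ × ℂ => Real.log ‖p.1 - p.2‖).stronglyMeasurable
  exact this.integral_prod_right'.measurable

/-! ### Cutting the parametrized measure into pieces of mass two -/

lemma map_restrict_Ioc_eq_sum {g : ℝ → ℂ} (hg : Measurable g) (n : ℕ) :
    Measure.map g (volume.restrict (Set.Ioc 0 (2 * (n : ℝ))))
      = ∑ k ∈ Finset.range n,
        Measure.map g (volume.restrict (Set.Ioc (2 * (k : ℝ)) (2 * ((k + 1 : ℕ) : ℝ)))) := by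
  induction n with
  | zero => simp
  | succ n ih =>
    rw [Finset.sum_range_succ, ← ih, ← Measure.map_add _ _ hg,
      ← Measure.restrict_union (Set.Ioc_disjoint_Ioc_of_le le_rfl) measurableSet_Ioc,
      Set.Ioc_union_Ioc_eq_Ioc (by positivity) (by push_cast; linarith)]

lemma map_restrict_Ioc_univ {g : ℝ → ℂ} (hg : Measurable g) (a b : ℝ) :
    Measure.map g (volume.restrict (Set.Ioc a b)) Set.univ = ENNReal.ofReal (b - a) := by
  rw [Measure.map_apply hg MeasurableSet.univ, Set.preimage_univ, Measure.restrict_apply_univ,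
    Real.volume_Ioc]

lemma exists_two_points_of_monotone {γ : ℝ → ℂ} (hγ : Continuous γ)
    (hH : ∀ s t, s ≤ t → ‖γ t - γ s‖ ^ 2 ≤ 1600 * (t - s)) {q : ℝ → ℝ} (hq : Monotone q)
    {ε : ℝ} (hε : 0 < ε) (a : ℝ) :
    ∃ x y : ℂ, ∫⁻ z, ‖∫ ζ, Real.log ‖z - ζ‖
          ∂(Measure.map (γ ∘ q) (volume.restrict (Set.Ioc a (a + 2))))
        - (Real.log ‖z - x‖ + Real.log ‖z - y‖)‖ₑ
      ≤ 4 * logRemainderBound * ENNReal.ofReal (1600 * (q (a + 2) - q a) + ε) := by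
  have hg : Measurable (γ ∘ q) := hγ.measurable.comp hq.measurable
  have h0 : 0 ≤ q (a + 2) - q a := sub_nonneg.2 (hq (by linarith))
  -- The summand `ε` keeps the radius positive when `q` is constant on the piece, as happens at a
  -- heavy atom.
  have hd : 0 < Real.sqrt (1600 * (q (a + 2) - q a) + ε) := Real.sqrt_pos.2 (by positivity)
  rw [← Real.sq_sqrt (show 0 ≤ 1600 * (q (a + 2) - q a) + ε by positivity)]
  refine exists_two_points_lintegral_le _ ?_ hd (c := γ (q a)) ?_
  · rw [map_restrict_Ioc_univ hg, add_sub_cancel_left, ENNReal.ofReal_ofNat]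
  · rw [ae_map_iff hg.aemeasurable
      (measurableSet_le (by fun_prop) measurable_const)]
    filter_upwards [self_mem_ae_restrict measurableSet_Ioc] with u hu
    refine Real.le_sqrt_of_sq_le ((hH _ _ (hq hu.1.le)).trans ?_)
    linarith [hq hu.2]

/-! ### Degree and logarithm of a polynomial with prescribed zeros -/

open Polynomial in
lemma degree_prod_mul_X_pow (x y : ℕ → ℂ) (n r : ℕ) :
    ((∏ k ∈ Finset.range n, (X - C (x k)) * (X - C (y k))) * X ^ r : ℂ[X]).degree
      = ((2 * n + r : ℕ) : WithBot ℕ) := by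
  have h1 : ∀ k ∈ Finset.range n, ((X - C (x k)) * (X - C (y k)) : ℂ[X]).Monic := fun k _ =>
    (monic_X_sub_C _).mul (monic_X_sub_C _)
  have h2 := (monic_prod_of_monic _ _ h1).mul (monic_X_pow r)
  rw [degree_eq_natDegree h2.ne_zero, (monic_prod_of_monic _ _ h1).natDegree_mul (monic_X_pow r),
    natDegree_prod_of_monic _ _ h1, natDegree_X_pow]
  simp only [(monic_X_sub_C _).natDegree_mul (monic_X_sub_C _), natDegree_X_sub_C,
    Finset.sum_const, Finset.card_range, smul_eq_mul]
  congr 1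
  push_cast
  ring

open Polynomial in
lemma log_norm_eval_prod_mul_X_pow {x y : ℕ → ℂ} {n r : ℕ} {z : ℂ}
    (hz : ((∏ k ∈ Finset.range n, (X - C (x k)) * (X - C (y k))) * X ^ r : ℂ[X]).eval z ≠ 0) :
    Real.log ‖((∏ k ∈ Finset.range n, (X - C (x k)) * (X - C (y k))) * X ^ r : ℂ[X]).eval z‖
      = ∑ k ∈ Finset.range n, (Real.log ‖z - x k‖ + Real.log ‖z - y k‖) + r * Real.log ‖z‖ := by
  simp only [eval_mul, eval_prod, eval_sub, eval_X, eval_C, eval_pow] at hz ⊢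
  obtain ⟨h1, h2⟩ := mul_ne_zero_iff.1 hz
  rw [Finset.prod_ne_zero_iff] at h1
  rw [norm_mul, Real.log_mul (norm_ne_zero_iff.2 (Finset.prod_ne_zero_iff.2 h1))
    (norm_ne_zero_iff.2 h2), norm_pow, Real.log_pow, norm_prod,
    Real.log_prod fun k hk => norm_ne_zero_iff.2 (h1 k hk)]
  congr 1
  refine Finset.sum_congr rfl fun k hk => ?_
  obtain ⟨h3, h4⟩ := mul_ne_zero_iff.1 (h1 k hk)
  rw [norm_mul, Real.log_mul (norm_ne_zero_iff.2 h3) (norm_ne_zero_iff.2 h4)]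

/-! ### Summing the errors of the pieces -/

theorem mainTheorem5 :
    ∃ C : NNReal, ∀ (N : ℕ) (μ : Measure ℂ),
      μ (closedSquare (1 / 2))ᶜ = 0 → μ (closedSquare (1 / 2)) = (N : ENNReal) →
        ∃ P : Polynomial ℂ, P.degree = (N : WithBot ℕ) ∧
          ∫⁻ z in closedSquare 1, (logPotential μ z - logAbs (P.eval z)).abs ∂volume
            < (C : ENNReal) := by
  -- `6406 = 4 * 1601 + 2`: the pairs, the leftover measure and the zero at the origin. The final
  -- `1` makes the inequality strict.
  refine ⟨6406 * logRemainderBound + 1, fun N μ hμ hN => ?_⟩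
  have hμu : μ Set.univ = N := by
    rw [← measure_add_measure_compl (measurableSet_closedSquare (1 / 2)), hμ, hN, add_zero]
  have : IsFiniteMeasure μ := ⟨by rw [hμu]; exact ENNReal.natCast_lt_top N⟩
  obtain ⟨γ, hγ, hH, hcov⟩ := exists_holder_curve_covering_square
  obtain ⟨q, hq, hq01, hmap⟩ := exists_monotone_map_comp_eq hγ N μ hμu
    (measure_mono_null (Set.compl_subset_compl.2 hcov) hμ)
  have hg : Measurable (γ ∘ q) := hγ.measurable.comp hq.measurable
  set n := N / 2 with hn
  set r := N % 2 with hr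
  have hNr : 2 * n + r = N := Nat.div_add_mod N 2
  have hr1 : (r : ℝ) ≤ 1 := by
    exact_mod_cast Nat.le_of_lt_succ (Nat.mod_lt N two_pos)
  have hNr' : 2 * (n : ℝ) + r = N := by exact_mod_cast hNr
  -- With this `ε` the `n` corrections add up to at most `1`.
  have hε : (0 : ℝ) < 1 / ((n : ℝ) + 1) := by positivity
  choose x y hxy using fun k : ℕ => exists_two_points_of_monotone hγ hH hq hε (2 * (k : ℝ))
  let ν : ℕ → Measure ℂ := fun k =>
    Measure.map (γ ∘ q) (volume.restrict (Set.Ioc (2 * (k : ℝ)) (2 * ((k + 1 : ℕ) : ℝ))))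
  let νr : Measure ℂ := Measure.map (γ ∘ q) (volume.restrict (Set.Ioc (2 * (n : ℝ)) (N : ℝ)))
  have hν : ∀ k, ν k = Measure.map (γ ∘ q)
      (volume.restrict (Set.Ioc (2 * (k : ℝ)) (2 * (k : ℝ) + 2))) := fun k => by
    simp only [ν]; push_cast; rw [mul_add, mul_one]
  have hsum : μ = ∑ k ∈ Finset.range n, ν k + νr := by
    rw [← map_restrict_Ioc_eq_sum hg, ← Measure.map_add _ _ hg,
      ← Measure.restrict_union (Set.Ioc_disjoint_Ioc_of_le le_rfl) measurableSet_Ioc,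
      Set.Ioc_union_Ioc_eq_Ioc (by positivity) (by linarith [r.cast_nonneg (α := ℝ)]), hmap]
  have hνle : ∀ k ∈ Finset.range n, ν k ≤ μ := fun k hk => by
    rw [hsum]
    exact (Finset.single_le_sum (f := ν) (fun i _ => Measure.zero_le _) hk).trans
      (Measure.le_add_right le_rfl)
  have hνrle : νr ≤ μ := by
    rw [hsum]; exact Measure.le_add_left le_rfl
  have hνfin : ∀ k, IsFiniteMeasure (ν k) := fun k =>
    ⟨by rw [map_restrict_Ioc_univ hg]; exact ENNReal.ofReal_lt_top⟩
  have hνrfin : IsFiniteMeasure νr :=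
    ⟨by rw [map_restrict_Ioc_univ hg]; exact ENNReal.ofReal_lt_top⟩
  have hball : ∀ᵐ ζ ∂μ, ‖ζ‖ ≤ 3 := by
    filter_upwards [compl_mem_ae_iff.2 hμ] with ζ hζ
    rw [compl_compl] at hζ
    linarith [Complex.norm_le_abs_re_add_abs_im ζ, hζ.1, hζ.2]
  let P : Polynomial ℂ := (∏ k ∈ Finset.range n, (Polynomial.X - Polynomial.C (x k)) *
    (Polynomial.X - Polynomial.C (y k))) * Polynomial.X ^ r
  have hdeg : P.degree = (N : WithBot ℕ) := by rw [degree_prod_mul_X_pow, hNr]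
  have hP0 : P ≠ 0 := fun h => by
    rw [h, Polynomial.degree_zero] at hdeg
    exact WithBot.bot_ne_coe hdeg
  refine ⟨P, hdeg, ?_⟩
  let E : ℕ → ℂ → ENNReal := fun k z =>
    ‖∫ ζ, Real.log ‖z - ζ‖ ∂(ν k) - (Real.log ‖z - x k‖ + Real.log ‖z - y k‖)‖ₑ
  have hEm : ∀ k, Measurable (E k) := fun k => by
    have := measurable_integral_log (ν k)
    fun_prop
  have hpt : ∀ᵐ z, (logPotential μ z - logAbs (P.eval z)).abs ≤
      (∑ k ∈ Finset.range n, E k z) + (‖∫ ζ, Real.log ‖z - ζ‖ ∂νr‖ₑ +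
        ‖∫ ζ, Real.log ‖z - ζ‖ ∂(Measure.dirac 0)‖ₑ) := by
    filter_upwards [ae_ae_ne μ,
      ae_integrable_log_norm_sub μ one_pos (c := 0) (by simpa using hball),
      compl_mem_ae_iff.2 ((Polynomial.finite_setOfPred_isRoot hP0).measure_zero volume)]
      with z h1 h2 h3
    have h4 : P.eval z ≠ 0 := h3
    rw [logPotential_eq_integral h1 h2, logAbs_of_ne_zero h4, log_norm_eval_prod_mul_X_pow h4,
      ← EReal.coe_sub, EReal.abs_def, ← Real.enorm_eq_ofReal_abs, integral_dirac, sub_zero]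
    have h5 : ∀ k ∈ Finset.range n, Integrable (fun ζ => Real.log ‖z - ζ‖) (ν k) := fun k hk =>
      h2.mono_measure (hνle k hk)
    have h6 : ∫ ζ, Real.log ‖z - ζ‖ ∂μ =
        ∑ k ∈ Finset.range n, ∫ ζ, Real.log ‖z - ζ‖ ∂(ν k) + ∫ ζ, Real.log ‖z - ζ‖ ∂νr := by
      conv_lhs => rw [hsum]
      rw [integral_add_measure (integrable_finsetSum_measure.2 h5) (h2.mono_measure hνrle),
        integral_finsetSum_measure h5]
    rw [h6, add_sub_add_comm, ← Finset.sum_sub_distrib]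
    refine (enorm_add_le _ _).trans (add_le_add (enorm_sum_le _ _)
      (enorm_sub_le.trans (add_le_add le_rfl ?_)))
    -- The factor `r` is `0` or `1`, so both parities are covered by the bound for one zero at the
    -- origin.
    rw [enorm_mul]
    refine mul_le_of_le_one_left zero_le ?_
    rw [Real.enorm_eq_ofReal r.cast_nonneg]
    exact ENNReal.ofReal_le_one.2 hr1
  have hsumd : ∑ k ∈ Finset.range n,
      (1600 * (q (2 * (k : ℝ) + 2) - q (2 * (k : ℝ))) + 1 / ((n : ℝ) + 1)) ≤ 1601 := by
    have e : ∀ k : ℕ, q (2 * (k : ℝ) + 2) = q (2 * ((k + 1 : ℕ) : ℝ)) := fun k => by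
      push_cast; rw [mul_add, mul_one]
    simp only [e]
    -- The increments of `q` telescope to `q (2 * n) - q 0 ≤ 1`.
    rw [Finset.sum_add_distrib, ← Finset.mul_sum,
      Finset.sum_range_sub (fun k : ℕ => q (2 * (k : ℝ))), Finset.sum_const, Finset.card_range,
      nsmul_eq_mul, mul_one_div]
    have h1 : (n : ℝ) / ((n : ℝ) + 1) ≤ 1 := by
      rw [div_le_one (by positivity)]; linarith
    have h2 := (hq01 (2 * (n : ℝ)) ⟨by positivity, by linarith [r.cast_nonneg (α := ℝ)]⟩).2
    have h3 := (hq01 0 ⟨le_rfl, N.cast_nonneg⟩).1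
    rw [Nat.cast_zero, mul_zero]
    linarith
  have hE : ∑ k ∈ Finset.range n, ∫⁻ z in closedSquare 1, E k z ≤ 6404 * logRemainderBound := by
    calc ∑ k ∈ Finset.range n, ∫⁻ z in closedSquare 1, E k z
        ≤ ∑ k ∈ Finset.range n, 4 * logRemainderBound * ENNReal.ofReal
            (1600 * (q (2 * (k : ℝ) + 2) - q (2 * (k : ℝ))) + 1 / ((n : ℝ) + 1)) := by
          refine Finset.sum_le_sum fun k _ => (setLIntegral_le_lintegral _ _).trans ?_
          simp only [E, hν]
          exact hxy k
      _ = 4 * logRemainderBound * ENNReal.ofReal (∑ k ∈ Finset.range n,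
            (1600 * (q (2 * (k : ℝ) + 2) - q (2 * (k : ℝ))) + 1 / ((n : ℝ) + 1))) := by
          rw [← Finset.mul_sum, ENNReal.ofReal_sum_of_nonneg]
          intro k _
          have : 0 ≤ q (2 * (k : ℝ) + 2) - q (2 * (k : ℝ)) := sub_nonneg.2 (hq (by linarith))
          positivity
      _ ≤ 4 * logRemainderBound * 1601 := by
          gcongr
          exact (ENNReal.ofReal_le_ofReal hsumd).trans_eq (by norm_num)
      _ = 6404 * logRemainderBound := by ring
  have hνr : ∫⁻ z in closedSquare 1, ‖∫ ζ, Real.log ‖z - ζ‖ ∂νr‖ₑ ≤ logRemainderBound := by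
    refine (setLIntegral_integral_log_le νr (ae_mono hνrle hball)).trans
      (mul_le_of_le_one_right zero_le ?_)
    rw [map_restrict_Ioc_univ hg]
    exact ENNReal.ofReal_le_one.2 (by linarith)
  have hdirac : ∫⁻ z in closedSquare 1, ‖∫ ζ, Real.log ‖z - ζ‖ ∂(Measure.dirac 0)‖ₑ
      ≤ logRemainderBound := by
    refine (setLIntegral_integral_log_le (Measure.dirac 0) ?_).trans_eq ?_
    · rw [ae_dirac_eq]; simp
    · rw [measure_univ, mul_one]
  calc ∫⁻ z in closedSquare 1, (logPotential μ z - logAbs (P.eval z)).abs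
      ≤ ∫⁻ z in closedSquare 1, ((∑ k ∈ Finset.range n, E k z) +
          (‖∫ ζ, Real.log ‖z - ζ‖ ∂νr‖ₑ + ‖∫ ζ, Real.log ‖z - ζ‖ ∂(Measure.dirac 0)‖ₑ)) :=
        lintegral_mono_ae (ae_restrict_of_ae hpt)
    _ = (∑ k ∈ Finset.range n, ∫⁻ z in closedSquare 1, E k z) +
          ((∫⁻ z in closedSquare 1, ‖∫ ζ, Real.log ‖z - ζ‖ ∂νr‖ₑ) +
            ∫⁻ z in closedSquare 1, ‖∫ ζ, Real.log ‖z - ζ‖ ∂(Measure.dirac 0)‖ₑ) := by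
        rw [lintegral_add_left (Finset.measurable_fun_sum _ fun k _ => hEm k),
          lintegral_finsetSum _ fun k _ => hEm k,
          lintegral_add_left (measurable_integral_log νr).enorm]
    _ ≤ 6404 * logRemainderBound + (logRemainderBound + logRemainderBound) :=
        add_le_add hE (add_le_add hνr hdirac)
    _ = ((6406 * logRemainderBound : NNReal) : ENNReal) := by push_cast; ring
    _ < ((6406 * logRemainderBound + 1 : NNReal) : ENNReal) := by
        exact_mod_cast lt_add_one _
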